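/- Let $\alpha\in(0,\tfrac12)$ and let $X$ be a real random variable with distribution function $F_X$. For a distribution function $F$ put $\mathrm{VaR}_u(F)=\inf\{t\in\mathbb R: F(t)\ge u\}$, $\mathrm{VaR}_u(X)=\mathrm{VaR}_u(F_X)$, $$\mathrm{ES}_\alpha(F)=\frac1\alpha\int_{1-\alpha}^1\mathrm{VaR}_u(F)\,du,\qquad \mathrm{ES}_\alpha(X)=\mathrm{ES}_\alpha(F_X),$$ $$\sigma^2_{\mathrm{ES}_\alpha(X)}=\frac1{\alpha^2}\int_{\mathrm{VaR}_{1-\alpha}(X)}^\infty\int_{\mathrm{VaR}_{1-\alpha}(X)}^\infty \bigl(F_X(\min\{t,s\})-F_X(t)F_X(s)\bigr)\,dt\,ds\in[0,\infty].$$ *The estimator.* Let $x_1,\dots,x_N\in\mathbb R$ be data, let $\varepsilon>0$ and let $0.35\le\beta_1\le\beta_2\le0.65$. For a nonempty set $I$ of indices let $\widehat F_I(t)=\frac1{|I|}\,|\{i\in I:x_i\le t\}|$ and $\widehat T_I=\mathrm{ES}_\alpha(\widehat F_I)$. Put $\widehat T_N=\widehat T_{\{1,\dots,N\}}$, $m=\lceil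 11/\varepsilon^2\rceil$, $n=\lfloor N/m\rfloor$, and $I_j=\{(j-1)m+1,\dots,jm\}$ for $1\le j\le n$. Let $\widehat T_{(1)}\le\dots\le\widehat T_{(n)}$ be the order statistics of $\widehat T_{I_1},\dots,\widehat T_{I_n}$, and let $\widehat Q:[0,1]\to\mathbb R$ be the function with $\widehat Q\bigl(\tfrac{j-1}{n-1}\bigr)=\widehat T_{(j)}$ for $1\le j\le n$ that is linear between these points ($\widehat Q$ is constant if $n=1$; the case $n=0$, where it can be defined arbitrarily, is irrelevant for the limit below). The estimator is $$\widehat S_N=\min\bigl\{\max\{\widehat T_N,\widehat Q(\beta_1)\},\widehat Q(\beta_2)\bigr\}.$$ *Statement.* Let $X_1,X_2,\dots$ be i.i.d. copies of $X$. Assume that $\sigma^2_{\mathrm{ES}_\alpha(X)}<\infty$ and that $u\mapsto\mathrm{VaR}_u(X)$ is Lipschitz continuous on a neighbourhood of $1-\alpha$. Let $(K_N)$ be a sequence of nonnegative integers with $K_N\ge1$ for all large $N$ and $\lim_{N\to\infty}K_N/N=0$. For every $N$ let $\widetilde X^N_1,\dots,\widetilde X^N_N$ be modified data such that, almost surely,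 $\widetilde X^N_i\ne X_i$ for at most $K_N$ indices $i\in\{1,\dots,N\}$; the modification is otherwise arbitrary and may depend on all of the data and on the estimator. Let $\widehat S_N$ be computed from $\widetilde X^N_1,\dots,\widetilde X^N_N$ with $\varepsilon=\varepsilon_N:=12\sqrt{K_N/N}$ and fixed $\beta_1,\beta_2$. Then the integral defining $\mathrm{ES}_\alpha(X)$ converges, and $$\widehat S_N\longrightarrow\mathrm{ES}_\alpha(X)\quad\text{in probability as }N\to\infty .$$ -/

import Mathlib

open MeasureTheory ProbabilityTheory Filter Topology
open scoped NNReal ENNReal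

namespace ExpectedShortfall

noncomputable section

/-- The value at risk at level `u` of a distribution function `F`, that is, the lower quantile
`inf {t : F t ≥ u}`. -/
def VaR (F : ℝ → ℝ) (u : ℝ) : ℝ := sInf {t : ℝ | u ≤ F t}

/-- The expected shortfall at level `α` of a distribution function `F`. -/
def ES (α : ℝ) (F : ℝ → ℝ) : ℝ := 1 / α * ∫ u in (1 - α)..1, VaR F u

/-- The variance associated to the estimation of the expected shortfall, with values in `[0, ∞]`.
For a distribution function the integrand is nonnegative, so that `ENNReal.ofReal` does not
change it. -/
def sigmaSq (α : ℝ) (F : ℝ → ℝ) : ℝ≥0∞ :=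
  ENNReal.ofReal (1 / α ^ 2) *
    ∫⁻ t in Set.Ioi (VaR F (1 - α)), ∫⁻ s in Set.Ioi (VaR F (1 - α)),
      ENNReal.ofReal (F (min t s) - F t * F s)

/-- The empirical distribution function of the data points `x i` with index `i` in `I`. -/
def empiricalCDF {ι : Type*} (x : ι → ℝ) (I : Finset ι) (t : ℝ) : ℝ :=
  ((I.filter fun i => x i ≤ t).card : ℝ) / (I.card : ℝ)

/-- The plug-in estimator of the expected shortfall that uses the data points with index in `I`. -/
def plugIn {ι : Type*} (α : ℝ) (x : ι → ℝ) (I : Finset ι) : ℝ := ES α (empiricalCDF x I)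

/-- The `j`-th block of length `m` (blocks and data points are counted from `0`):
`{j m, ..., (j + 1) m - 1}`. It has exactly `m` elements when `(j + 1) m ≤ N`. -/
def block (N m j : ℕ) : Finset (Fin N) :=
  Finset.univ.filter fun i => j * m ≤ (i : ℕ) ∧ (i : ℕ) < (j + 1) * m

/-- The order statistics of `T`, counted from `0` (and `0` when the index is out of range):
`Tuple.sort T` is a permutation for which `T ∘ Tuple.sort T` is monotone. -/
def orderStat {n : ℕ} (T : Fin n → ℝ) (k : ℕ) : ℝ :=
  if h : k < n then T (Tuple.sort T ⟨k, h⟩) else 0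

/-- The linearly interpolated empirical quantile function on `[0, 1]`: its value at
`k / (n - 1)` is the order statistic with index `k` (counted from `0`), for `k = 0, ..., n - 1`,
and it is linear in between. -/
def quantile {n : ℕ} (T : Fin n → ℝ) (β : ℝ) : ℝ :=
  let h : ℝ := β * ((n : ℝ) - 1)
  let k : ℕ := ⌊h⌋₊
  orderStat T k + (h - k) * (orderStat T (k + 1) - orderStat T k)

/-- The block size `m = ⌈11 / ε ^ 2⌉`. -/
def blockSize (ε : ℝ) : ℕ := ⌈11 / ε ^ 2⌉₊

/-- The plug-in estimators on the `n = ⌊N / m⌋` disjoint blocks of length `m`. -/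
def blockEstimates (α ε : ℝ) {N : ℕ} (x : Fin N → ℝ) (j : Fin (N / blockSize ε)) : ℝ :=
  plugIn α x (block N (blockSize ε) j)

/-- The estimator: the plug-in estimator on the whole data set, truncated at the `β₁`- and
`β₂`-quantiles of the block estimators. -/
def estimator (α β₁ β₂ ε : ℝ) {N : ℕ} (x : Fin N → ℝ) : ℝ :=
  min (max (plugIn α x Finset.univ) (quantile (blockEstimates α ε x) β₁))
    (quantile (blockEstimates α ε x) β₂)

end

end ExpectedShortfall

namespace ExpectedShortfall

open Set

/-! Two deterministic facts reduce the claim to a law of large numbers. Stability: expected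
shortfall is the minimum over `c` of `c + E (X - c)⁺ / α`, attained at `c = VaR (1 - α)`. Comparing
the minimisers of the true and of an empirical law shows that the plug-in estimator is within `δ` of
the target once the empirical averages of four fixed integrable functions are close to their means
(`exists_test_functions`). Integrability of `(X - c)⁺` comes from the finite variance
(`integrable_of_sigmaSq_ne_top`). Robustness: the block length tends to infinity, so by the law of
large numbers a clean block is atypical with probability tending to 0, and Markov's inequality makes
at least `n / 50` atypical blocks unlikely. Eventually the modified data touch at most `K ≤ n / 13`
blocks. As `1 / 13 + 1 / 50 < 1 / 10`, the central quantiles of the block estimates lie within `δ`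
of the target, and truncation forces the estimator there as well. -/

theorem ae_nonneg_max_zero {β : Type*} [MeasurableSpace β] (μ : Measure β) (f : β → ℝ) :
    0 ≤ᵐ[μ] fun x => max (f x) 0 :=
  Eventually.of_forall fun _ => le_max_right _ _

/-! ### Quantiles and the tail formula for expected shortfall -/

/-- Right-continuity makes the infimum a minimum. For `u` strictly between 0 and 1 the set is
nonempty and bounded below, so `sInf` takes no default value. -/
theorem VaR_le_iff (ν : Measure ℝ) {u : ℝ} (hu0 : 0 < u) (hu1 : u < 1) (t : ℝ) :
    VaR (cdf ν) u ≤ t ↔ u ≤ cdf ν t := by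
  have hne : {t : ℝ | u ≤ cdf ν t}.Nonempty := by
    obtain ⟨t, ht⟩ := ((tendsto_cdf_atTop ν).eventually (lt_mem_nhds hu1)).exists
    exact ⟨t, ht.le⟩
  have hbdd : BddBelow {t : ℝ | u ≤ cdf ν t} := by
    obtain ⟨a, ha⟩ := ((tendsto_cdf_atBot ν).eventually (gt_mem_nhds hu0)).exists
    refine ⟨a, fun t ht => le_of_not_gt fun hta => ?_⟩
    exact absurd (ht.trans (monotone_cdf ν hta.le)) (not_le.2 ha)
  refine ⟨fun h => ?_, fun h => csInf_le hbdd h⟩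
  refine le_trans ?_ (monotone_cdf ν h)
  have hcont : Tendsto (cdf ν) (𝓝[>] VaR (cdf ν) u) (𝓝 (cdf ν (VaR (cdf ν) u))) :=
    ((cdf ν).right_continuous _).mono Ioi_subset_Ici_self
  refine ge_of_tendsto hcont ?_
  filter_upwards [self_mem_nhdsWithin] with t ht
  obtain ⟨s, hs, hst⟩ := exists_lt_of_csInf_lt hne ht
  exact le_trans hs (monotone_cdf ν hst.le)

theorem lt_VaR_iff (ν : Measure ℝ) {u : ℝ} (hu0 : 0 < u) (hu1 : u < 1) (t : ℝ) :
    t < VaR (cdf ν) u ↔ cdf ν t < u := by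
  rw [← not_le, VaR_le_iff ν hu0 hu1, not_le]

theorem monotoneOn_VaR (ν : Measure ℝ) : MonotoneOn (VaR (cdf ν)) (Ioo 0 1) := by
  intro u hu w hw huw
  rw [VaR_le_iff ν hu.1 hu.2]
  exact huw.trans ((VaR_le_iff ν hw.1 hw.2 _).1 le_rfl)

theorem measure_Ioi_eq_cdf (ν : Measure ℝ) [IsProbabilityMeasure ν] (t : ℝ) :
    ν (Ioi t) = ENNReal.ofReal (1 - cdf ν t) := by
  rw [← compl_Iic, prob_compl_eq_one_sub measurableSet_Iic, ← ofReal_cdf,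
    ENNReal.ofReal_sub _ (cdf_nonneg ν t), ENNReal.ofReal_one]

theorem aemeasurable_VaR (ν : Measure ℝ) {α : ℝ} (hα1 : α < 1) :
    AEMeasurable (VaR (cdf ν)) (volume.restrict (Ioo (1 - α) 1)) :=
  aemeasurable_restrict_of_monotoneOn measurableSet_Ioo
    ((monotoneOn_VaR ν).mono (Ioo_subset_Ioo_left (by linarith)))

/-- Quantile transform by the layer-cake formula: for `t > 0` the levels with quantile above `c + t`
form the interval from `cdf ν (c + t)` to 1, whose length is the mass beyond `c + t`. Being a
`lintegral` identity, it also transfers integrability. -/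
theorem lintegral_VaR_sub (ν : Measure ℝ) [IsProbabilityMeasure ν]
    {α : ℝ} (hα0 : 0 < α) (hα1 : α < 1) :
    ∫⁻ u in Ioo (1 - α) 1, ENNReal.ofReal (max (VaR (cdf ν) u - VaR (cdf ν) (1 - α)) 0) =
      ∫⁻ x, ENNReal.ofReal (max (x - VaR (cdf ν) (1 - α)) 0) ∂ν := by
  set c := VaR (cdf ν) (1 - α) with hc
  have hFc : 1 - α ≤ cdf ν c := (VaR_le_iff ν (by linarith) (by linarith) c).1 le_rfl
  rw [lintegral_eq_lintegral_meas_lt _ (ae_nonneg_max_zero _ _)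
      (((aemeasurable_VaR ν hα1).sub_const c).max aemeasurable_const),
    lintegral_eq_lintegral_meas_lt _ (ae_nonneg_max_zero _ _)
      (by fun_prop)]
  refine setLIntegral_congr_fun measurableSet_Ioi fun t (ht : 0 < t) => ?_
  have h1 : {x : ℝ | t < max (x - c) 0} = Ioi (c + t) := by
    ext x
    simp only [mem_ofPred_eq, lt_max_iff, mem_Ioi]
    constructor
    · rintro (h | h) <;> linarith
    · intro h
      left
      linarith
  have hFt : 1 - α ≤ cdf ν (c + t) := hFc.trans (monotone_cdf ν (by linarith))
  have h2 : {u : ℝ | t < max (VaR (cdf ν) u - c) 0} ∩ Ioo (1 - α) 1 =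
      Ioo (cdf ν (c + t)) 1 := by
    ext u
    simp only [mem_inter_iff, mem_ofPred_eq, lt_max_iff, mem_Ioo]
    constructor
    · rintro ⟨h | h, hu⟩
      · exact ⟨(lt_VaR_iff ν (by linarith) hu.2 _).1 (by linarith), hu.2⟩
      · linarith
    · rintro ⟨h, hu⟩
      have := (lt_VaR_iff ν (by linarith) hu _).2 h
      exact ⟨Or.inl (by linarith), by linarith, hu⟩
  rw [h1, Measure.restrict_apply' measurableSet_Ioo, h2, Real.volume_Ioo, measure_Ioi_eq_cdf]

theorem integrableOn_VaR_sub (ν : Measure ℝ) [IsProbabilityMeasure ν]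
    {α : ℝ} (hα0 : 0 < α) (hα1 : α < 1)
    (hint : Integrable (fun x => max (x - VaR (cdf ν) (1 - α)) 0) ν) :
    IntegrableOn (fun u => max (VaR (cdf ν) u - VaR (cdf ν) (1 - α)) 0) (Ioo (1 - α) 1) := by
  refine ⟨(((aemeasurable_VaR ν hα1).sub_const _).max
    aemeasurable_const).aestronglyMeasurable, ?_⟩
  rw [hasFiniteIntegral_iff_ofReal (ae_nonneg_max_zero _ _),
    lintegral_VaR_sub ν hα0 hα1,
    ← hasFiniteIntegral_iff_ofReal (ae_nonneg_max_zero _ _)]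
  exact hint.2

theorem VaR_eq_add_max (ν : Measure ℝ)
    {α : ℝ} (hα0 : 0 < α) (hα1 : α < 1)
    {u : ℝ} (hu : u ∈ Ioo (1 - α) 1) :
    VaR (cdf ν) u = max (VaR (cdf ν) u - VaR (cdf ν) (1 - α)) 0 + VaR (cdf ν) (1 - α) := by
  have : VaR (cdf ν) (1 - α) ≤ VaR (cdf ν) u :=
    monotoneOn_VaR ν ⟨by linarith, by linarith⟩ ⟨by linarith [hu.1], hu.2⟩ hu.1.le
  rw [max_eq_left (by linarith)]
  ring

theorem intervalIntegrable_VaR (ν : Measure ℝ) [IsProbabilityMeasure ν]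
    {α : ℝ} (hα0 : 0 < α) (hα1 : α < 1)
    (hint : Integrable (fun x => max (x - VaR (cdf ν) (1 - α)) 0) ν) :
    IntervalIntegrable (VaR (cdf ν)) volume (1 - α) 1 := by
  rw [intervalIntegrable_iff_integrableOn_Ioo_of_le (by linarith)]
  refine IntegrableOn.congr_fun ((integrableOn_VaR_sub ν hα0 hα1 hint).add
    (integrableOn_const (by simp) (C := VaR (cdf ν) (1 - α)))) ?_ measurableSet_Ioo
  exact fun u hu => (VaR_eq_add_max ν hα0 hα1 hu).symm

theorem mul_ES_eq (ν : Measure ℝ) [IsProbabilityMeasure ν]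
    {α : ℝ} (hα0 : 0 < α) (hα1 : α < 1)
    (hint : Integrable (fun x => max (x - VaR (cdf ν) (1 - α)) 0) ν) :
    α * ES α (cdf ν) = α * VaR (cdf ν) (1 - α) +
      ∫ x, max (x - VaR (cdf ν) (1 - α)) 0 ∂ν := by
  have h1 : ∫ u in Ioo (1 - α) 1, max (VaR (cdf ν) u - VaR (cdf ν) (1 - α)) 0 =
      ∫ x, max (x - VaR (cdf ν) (1 - α)) 0 ∂ν := by
    rw [integral_eq_lintegral_of_nonneg_ae (ae_nonneg_max_zero _ _)
        (integrableOn_VaR_sub ν hα0 hα1 hint).1,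
      integral_eq_lintegral_of_nonneg_ae (ae_nonneg_max_zero _ _) hint.1,
      lintegral_VaR_sub ν hα0 hα1]
  have h2 : ∫ u in Ioo (1 - α) 1, VaR (cdf ν) u = ∫ u in Ioo (1 - α) 1,
      (max (VaR (cdf ν) u - VaR (cdf ν) (1 - α)) 0 + VaR (cdf ν) (1 - α)) :=
    setIntegral_congr_fun measurableSet_Ioo fun u hu => VaR_eq_add_max ν hα0 hα1 hu
  rw [ES, ← mul_assoc, mul_one_div_cancel hα0.ne', one_mul,
    intervalIntegral.integral_of_le (by linarith), integral_Ioc_eq_integral_Ioo, h2,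
    integral_add (integrableOn_VaR_sub ν hα0 hα1 hint) (integrableOn_const (by simp)), h1]
  simp [hα0.le]
  ring

/-- A randomised tail event of probability exactly `α`. -/
theorem exists_tail_weight (ν : Measure ℝ) [IsProbabilityMeasure ν]
    {α : ℝ} (hα0 : 0 < α) (hα1 : α < 1) :
    ∃ φ : ℝ → ℝ, Measurable φ ∧ (∀ x, 0 ≤ φ x) ∧ (∀ x, φ x ≤ 1) ∧
    ∫ x, φ x ∂ν = α ∧
    ∀ x, φ x * (x - VaR (cdf ν) (1 - α)) = max (x - VaR (cdf ν) (1 - α)) 0 := by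
  set c := VaR (cdf ν) (1 - α) with hc
  have hFc : 1 - α ≤ cdf ν c := (VaR_le_iff ν (by linarith) (by linarith) c).1 le_rfl
  have hIoi : ν.real (Ioi c) ≤ α := by
    rw [measureReal_def, measure_Ioi_eq_cdf, ENNReal.toReal_ofReal (by linarith [cdf_le_one ν c])]
    linarith
  have hIio : ν.real (Iio c) ≤ 1 - α := by
    have hl : Function.leftLim (cdf ν) c ≤ 1 - α := by
      refine le_of_tendsto ((monotone_cdf ν).tendsto_leftLim c) ?_
      filter_upwards [self_mem_nhdsWithin] with t ht
      exact ((lt_VaR_iff ν (by linarith) (by linarith) t).1 ht).le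
    rw [measureReal_def, ← measure_cdf ν, StieltjesFunction.measure_Iio _ (tendsto_cdf_atBot ν)]
    refine ENNReal.toReal_le_of_le_ofReal (by linarith) (ENNReal.ofReal_le_ofReal ?_)
    rwa [sub_zero]
  have hsum : ν.real (Iio c) + ν.real {c} + ν.real (Ioi c) = 1 := by
    rw [← measureReal_union (by simp) (measurableSet_singleton c), Iio_union_right,
      ← measureReal_union (by simp) measurableSet_Ioi, Iic_union_Ioi]
    simp
  -- The law may have an atom at `c`; the fraction `θ` of it tops up the mass beyond `c` to exactly
  -- `α`.
  obtain ⟨θ, hθ0, hθ1, hθ⟩ : ∃ θ : ℝ, 0 ≤ θ ∧ θ ≤ 1 ∧ ν.real (Ioi c) + θ * ν.real {c} = α := by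
    rcases (measureReal_nonneg (μ := ν) (s := {c})).eq_or_lt with h | h
    · exact ⟨0, le_rfl, zero_le_one, by linarith⟩
    · refine ⟨(α - ν.real (Ioi c)) / ν.real {c}, div_nonneg (by linarith) h.le,
        (div_le_one h).2 (by linarith), ?_⟩
      rw [div_mul_cancel₀ _ h.ne']
      ring
  refine ⟨fun x => (Ioi c).indicator 1 x + θ * ({c} : Set ℝ).indicator 1 x, ?_, ?_, ?_, ?_, ?_⟩
  · exact (measurable_one.indicator measurableSet_Ioi).add
      ((measurable_one.indicator (measurableSet_singleton c)).const_mul θ)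
  · intro x
    exact add_nonneg (indicator_nonneg (by simp) _)
      (mul_nonneg hθ0 (indicator_nonneg (by simp) _))
  · intro x
    rcases lt_trichotomy x c with h | rfl | h
    · simp [indicator, h.ne, not_lt.2 h.le]
    · simpa using hθ1
    · simp [indicator, h.ne', h]
  · rw [integral_add, integral_const_mul, integral_indicator_one measurableSet_Ioi,
      integral_indicator_one (measurableSet_singleton c), hθ]
    · exact (integrable_const 1).indicator measurableSet_Ioi
    · exact ((integrable_const 1).indicator (measurableSet_singleton c)).const_mul θ
  · intro x
    rcases lt_trichotomy x c with h | rfl | h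
    · simp [indicator, h.ne, h.le, not_lt.2 h.le]
    · simp
    · simp [indicator, h.ne', h, h.le]

/-- Subgradient inequality for `d ↦ ∫ (x - d)⁺`: pointwise `(x - d)⁺ ≥ φ x * (x - d) = (x - c)⁺ - (d
- c) * φ x`. -/
theorem integral_max_sub_le (ν : Measure ℝ) [IsProbabilityMeasure ν] {c : ℝ} {φ : ℝ → ℝ}
    (hφm : Measurable φ) (hφ0 : ∀ x, 0 ≤ φ x) (hφ1 : ∀ x, φ x ≤ 1)
    (hφ : ∀ x, φ x * (x - c) = max (x - c) 0) (d : ℝ)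
    (hc : Integrable (fun x => max (x - c) 0) ν) (hd : Integrable (fun x => max (x - d) 0) ν) :
    ∫ x, max (x - c) 0 ∂ν - (d - c) * ∫ x, φ x ∂ν ≤ ∫ x, max (x - d) 0 ∂ν := by
  have hφi : Integrable φ ν := by
    refine Integrable.of_bound hφm.aestronglyMeasurable 1 (Eventually.of_forall fun x => ?_)
    rw [Real.norm_of_nonneg (hφ0 x)]
    exact hφ1 x
  rw [← integral_const_mul, ← integral_sub hc (hφi.const_mul _)]
  refine integral_mono (hc.sub (hφi.const_mul _)) hd fun x => ?_
  have h1 : φ x * (x - d) ≤ max (x - d) 0 := by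
    rcases le_total (x - d) 0 with h | h
    · exact (mul_nonpos_of_nonneg_of_nonpos (hφ0 x) h).trans (le_max_right _ _)
    · exact (mul_le_of_le_one_left h (hφ1 x)).trans (le_max_left _ _)
  have h2 := hφ x
  simp only
  linarith

/-! ### Empirical measures and stability of the plug-in estimator -/

section Empirical

variable {ι : Type*}

/-- The uniform distribution on the data points `x i` with `i` in `I`. -/
noncomputable def empiricalMeasure (x : ι → ℝ) (I : Finset ι) : Measure ℝ :=
  ∑ i ∈ I, (I.card : ℝ≥0∞)⁻¹ • Measure.dirac (x i)

theorem isProbabilityMeasure_empiricalMeasure (x : ι → ℝ) {I : Finset ι} (hI : I.Nonempty) :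
    IsProbabilityMeasure (empiricalMeasure x I) := by
  constructor
  simp only [empiricalMeasure, Measure.coe_finsetSum, Finset.sum_apply, Measure.smul_apply,
    measure_univ, smul_eq_mul, mul_one, Finset.sum_const, nsmul_eq_mul]
  exact ENNReal.mul_inv_cancel (by simpa using hI.ne_empty) (by simp)

theorem integrable_empiricalMeasure (x : ι → ℝ) (I : Finset ι) (f : ℝ → ℝ) :
    Integrable f (empiricalMeasure x I) := by
  rcases I.eq_empty_or_nonempty with rfl | hI
  · simp [empiricalMeasure]
  refine integrable_finsetSum_measure.2 fun i _ => ?_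
  exact (integrable_dirac (by simp)).smul_measure (by simpa using hI.ne_empty)

theorem integral_empiricalMeasure (x : ι → ℝ) (I : Finset ι) (f : ℝ → ℝ) :
    ∫ y, f y ∂(empiricalMeasure x I) = (∑ i ∈ I, f (x i)) / I.card := by
  rcases I.eq_empty_or_nonempty with rfl | hI
  · simp [empiricalMeasure]
  rw [empiricalMeasure, integral_finsetSum_measure, Finset.sum_div]
  · refine Finset.sum_congr rfl fun i _ => ?_
    rw [integral_smul_measure, integral_dirac]
    simp [div_eq_inv_mul]
  · intro i _
    exact (integrable_dirac (by simp)).smul_measure (by simpa using hI.ne_empty)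

theorem empiricalCDF_eq_sum (x : ι → ℝ) (I : Finset ι) (t : ℝ) :
    empiricalCDF x I t = (∑ i ∈ I, (Iic t).indicator (fun _ => (1 : ℝ)) (x i)) / I.card := by
  simp [empiricalCDF, indicator]

theorem cdf_empiricalMeasure (x : ι → ℝ) {I : Finset ι} (hI : I.Nonempty) :
    cdf (empiricalMeasure x I) = empiricalCDF x I := by
  have := isProbabilityMeasure_empiricalMeasure x hI
  ext t
  rw [cdf_eq_real, empiricalCDF_eq_sum, ← integral_empiricalMeasure,
    ← integral_indicator_one measurableSet_Iic]
  rfl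

/-- The plug-in estimator is close to the expected shortfall as soon as the empirical averages of
four suitable functions are close to their expectations. -/
theorem exists_test_functions (μ : Measure ℝ) [IsProbabilityMeasure μ]
    {α : ℝ} (hα0 : 0 < α) (hα1 : α < 1)
    (hint : Integrable (fun x => max (x - VaR (cdf μ) (1 - α)) 0) μ) {δ : ℝ} (hδ : 0 < δ) :
    ∃ f : Fin 4 → ℝ → ℝ, (∀ k, Measurable (f k)) ∧ (∀ k, Integrable (f k) μ) ∧
      ∃ η > 0, ∀ (ι : Type) (x : ι → ℝ) (I : Finset ι), I.Nonempty →
        (∀ k, |(∑ i ∈ I, f k (x i)) / I.card - ∫ y, f k y ∂μ| < η) →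
        |plugIn α x I - ES α (cdf μ)| < δ := by
  obtain ⟨φ, hφm, hφ0, hφ1, hφα, hφ⟩ := exists_tail_weight μ hα0 hα1
  set c := VaR (cdf μ) (1 - α) with hc
  -- Closeness of the two distribution functions at `a` and `b` confines the empirical quantile `d`
  -- to `(a, b]`, hence `|d - c| ≤ R`.
  obtain ⟨a, ha⟩ :=
    ((tendsto_cdf_atBot μ).eventually (gt_mem_nhds (show 0 < 1 - α by linarith))).exists
  obtain ⟨b, hb⟩ :=
    ((tendsto_cdf_atTop μ).eventually (lt_mem_nhds (show 1 - α < 1 by linarith))).exists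
  have hind (t : ℝ) : ∫ y, (Iic t).indicator (fun _ => (1 : ℝ)) y ∂μ = cdf μ t := by
    rw [cdf_eq_real, ← integral_indicator_one measurableSet_Iic]
    rfl
  have hindi (t : ℝ) : Integrable ((Iic t).indicator fun _ => (1 : ℝ)) μ :=
    (integrable_const 1).indicator measurableSet_Iic
  have hφi : Integrable φ μ := by
    refine Integrable.of_bound hφm.aestronglyMeasurable 1 (Eventually.of_forall fun x => ?_)
    rw [Real.norm_of_nonneg (hφ0 x)]
    exact hφ1 x
  set R := |a - c| + |b - c| + 1 with hR
  have hRpos : 0 < R := by positivity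
  refine ⟨![fun x => max (x - c) 0, φ, (Iic a).indicator fun _ => 1,
    (Iic b).indicator fun _ => 1], ?_, ?_, min (α * δ / (1 + R))
      (min (1 - α - cdf μ a) (cdf μ b - (1 - α))), ?_, ?_⟩
  · intro k
    fin_cases k
    · exact (measurable_id.sub_const c).max measurable_const
    · exact hφm
    · exact measurable_const.indicator measurableSet_Iic
    · exact measurable_const.indicator measurableSet_Iic
  · intro k
    fin_cases k
    exacts [hint, hφi, hindi a, hindi b]
  · exact lt_min (by positivity) (lt_min (by linarith) (by linarith))
  intro ι x I hI hk
  have := isProbabilityMeasure_empiricalMeasure x hI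
  have h0 : |(∑ i ∈ I, max (x i - c) 0) / I.card - ∫ y, max (y - c) 0 ∂μ| < _ := hk 0
  have h1 : |(∑ i ∈ I, φ (x i)) / I.card - ∫ y, φ y ∂μ| < _ := hk 1
  have h2 : |(∑ i ∈ I, (Iic a).indicator (fun _ => (1 : ℝ)) (x i)) / I.card -
    ∫ y, (Iic a).indicator (fun _ => (1 : ℝ)) y ∂μ| < _ := hk 2
  have h3 : |(∑ i ∈ I, (Iic b).indicator (fun _ => (1 : ℝ)) (x i)) / I.card -
    ∫ y, (Iic b).indicator (fun _ => (1 : ℝ)) y ∂μ| < _ := hk 3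
  rw [← empiricalCDF_eq_sum, ← cdf_empiricalMeasure x hI, hind, lt_min_iff, lt_min_iff,
    abs_lt (b := 1 - α - cdf μ a)] at h2
  rw [← empiricalCDF_eq_sum, ← cdf_empiricalMeasure x hI, hind, lt_min_iff, lt_min_iff,
    abs_lt (b := cdf μ b - (1 - α))] at h3
  rw [← integral_empiricalMeasure x I fun y => max (y - c) 0, lt_min_iff] at h0
  rw [← integral_empiricalMeasure, lt_min_iff, hφα] at h1
  rw [plugIn, ← cdf_empiricalMeasure x hI]
  have hIe := integrable_empiricalMeasure x I
  generalize empiricalMeasure x I = ν at *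
  obtain ⟨ψ, hψm, hψ0, hψ1, hψα, hψ⟩ := exists_tail_weight ν hα0 hα1
  have eμ := mul_ES_eq μ hα0 hα1 hint
  have eν := mul_ES_eq ν hα0 hα1 (hIe _)
  set d := VaR (cdf ν) (1 - α) with hd
  rw [← hc] at eμ
  have hda : a < d := (lt_VaR_iff ν (by linarith) (by linarith) a).2 (by linarith)
  have hdb : d ≤ b := (VaR_le_iff ν (by linarith) (by linarith) b).2 (by linarith)
  -- The weight `φ` of `μ` is tested against `ν`, where its mean is only near `α`; this costs `(d -
  -- c) * (∫ φ ∂ν - α)`. In the other direction `ψ` has mean exactly `α`, so nothing is lost.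
  have hlow := integral_max_sub_le ν hφm hφ0 hφ1 hφ d (hIe _) (hIe _)
  have hupp := integral_max_sub_le ν hψm hψ0 hψ1 hψ c (hIe _) (hIe _)
  rw [hψα] at hupp
  have hdc : |d - c| ≤ R := by
    rw [abs_le]
    constructor <;> linarith [neg_abs_le (a - c), le_abs_self (b - c), abs_nonneg (a - c),
      abs_nonneg (b - c)]
  have hprod : |(d - c) * (∫ y, φ y ∂ν - α)| ≤ R * (α * δ / (1 + R)) := by
    rw [abs_mul]
    exact mul_le_mul hdc h1.1.le (abs_nonneg _) hRpos.le
  have hsplit : α * δ / (1 + R) + R * (α * δ / (1 + R)) = α * δ := by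
    field_simp
  have habs : |α * (ES α (cdf ν) - ES α (cdf μ))| < α * δ := by
    have h0' := abs_lt.1 h0.1
    have hp' := abs_le.1 hprod
    have : 0 ≤ R * (α * δ / (1 + R)) := by positivity
    rw [mul_sub, eμ, eν, abs_lt]
    constructor <;> linarith
  rw [abs_mul, abs_of_pos hα0] at habs
  exact lt_of_mul_lt_mul_left habs hα0.le

end Empirical

/-! ### Integrability of the upper tail -/

/-- A distribution for which `sigmaSq` is finite has an integrable upper tail. -/
theorem integrable_of_sigmaSq_ne_top (μ : Measure ℝ) [IsProbabilityMeasure μ]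
    {α : ℝ} (hα0 : 0 < α) (hα1 : α < 1) (hσ : sigmaSq α (cdf μ) ≠ ∞) :
    Integrable (fun x => max (x - VaR (cdf μ) (1 - α)) 0) μ := by
  set c := VaR (cdf μ) (1 - α) with hc
  have hFc : 1 - α ≤ cdf μ c := (VaR_le_iff μ (by linarith) (by linarith) c).1 le_rfl
  have hnn := cdf_le_one μ
  have hmeas : Measurable (cdf μ) := (monotone_cdf μ).measurable
  have hdouble : ∫⁻ t in Ioi c, ∫⁻ s in Ioi c,
      ENNReal.ofReal (cdf μ (min t s) - cdf μ t * cdf μ s) ≠ ∞ := by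
    intro h
    apply hσ
    rw [sigmaSq, ← hc, h, ENNReal.mul_top]
    simp [hα0]
  have htail : ∫⁻ s in Ioi (c + 1), ENNReal.ofReal (1 - cdf μ s) ≠ ∞ := by
    -- On the strip `c < t ≤ c + 1 < s` the integrand is `F t * (1 - F s) ≥ (1 - α) * (1 - F s)`.
    have hle : ENNReal.ofReal (1 - α) * ∫⁻ s in Ioi (c + 1), ENNReal.ofReal (1 - cdf μ s) ≤
        ∫⁻ t in Ioi c, ∫⁻ s in Ioi c,
          ENNReal.ofReal (cdf μ (min t s) - cdf μ t * cdf μ s) := by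
      calc ENNReal.ofReal (1 - α) * ∫⁻ s in Ioi (c + 1), ENNReal.ofReal (1 - cdf μ s)
          = ∫⁻ t in Ioc c (c + 1), ENNReal.ofReal (1 - α) *
              ∫⁻ s in Ioi (c + 1), ENNReal.ofReal (1 - cdf μ s) := by
            simp
        _ ≤ ∫⁻ t in Ioc c (c + 1), ∫⁻ s in Ioi c,
              ENNReal.ofReal (cdf μ (min t s) - cdf μ t * cdf μ s) := by
            refine setLIntegral_mono' measurableSet_Ioc fun t ht => ?_
            rw [← lintegral_const_mul _ (by fun_prop)]
            refine le_trans ?_ (lintegral_mono_set (Ioi_subset_Ioi (by linarith : c ≤ c + 1)))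
            refine setLIntegral_mono' measurableSet_Ioi fun s (hs : c + 1 < s) => ?_
            rw [← ENNReal.ofReal_mul (by linarith), min_eq_left (ht.2.trans hs.le)]
            refine ENNReal.ofReal_le_ofReal ?_
            have h1 : 1 - α ≤ cdf μ t := hFc.trans (monotone_cdf μ ht.1.le)
            nlinarith [hnn s]
        _ ≤ _ := lintegral_mono_set Ioc_subset_Ioi_self
    intro h
    rw [h, ENNReal.mul_top (by simpa using hα1)] at hle
    exact hdouble (top_le_iff.1 hle)
  have hmax : Measurable fun x : ℝ => max (x - (c + 1)) 0 := by fun_prop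
  have hshift : Integrable (fun x => max (x - (c + 1)) 0) μ := by
    refine ⟨hmax.aestronglyMeasurable, ?_⟩
    rw [hasFiniteIntegral_iff_ofReal (ae_nonneg_max_zero _ _),
      lintegral_eq_lintegral_meas_lt _ (ae_nonneg_max_zero _ _) hmax.aemeasurable]
    refine lt_of_eq_of_lt ?_ (lt_top_iff_ne_top.2 htail)
    have himg : Ioi (0 : ℝ) = (fun t => t + (c + 1)) ⁻¹' Ioi (c + 1) := by
      ext t
      simp
    have hpre := (measurePreserving_add_right volume (c + 1)).setLIntegral_comp_preimage
      (measurableSet_Ioi (a := c + 1)) (f := fun s => ENNReal.ofReal (1 - cdf μ s)) (by fun_prop)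
    rw [← hpre, ← himg]
    refine setLIntegral_congr_fun measurableSet_Ioi fun t (ht : 0 < t) => ?_
    have h1 : {x : ℝ | t < max (x - (c + 1)) 0} = Ioi (t + (c + 1)) := by
      ext x
      simp only [mem_ofPred_eq, lt_max_iff, mem_Ioi]
      constructor
      · rintro (h | h) <;> linarith
      · intro h
        left
        linarith
    rw [h1, measure_Ioi_eq_cdf]
  refine Integrable.mono' (hshift.add (integrable_const 1))
    (by fun_prop) (Eventually.of_forall fun x => ?_)
  rw [Real.norm_of_nonneg (le_max_right _ _), Pi.add_apply]
  refine max_le ?_ ?_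
  · linarith [le_max_left (x - (c + 1)) 0]
  · linarith [le_max_right (x - (c + 1)) 0]

end ExpectedShortfall

namespace ExpectedShortfall

/-! ### Order statistics, blocks and the block size -/

/-- If all but `b` of the values lie within `δ` of `e`, then so do the order statistics that are
at least `b` places away from both ends. -/
theorem abs_orderStat_sub_le {n : ℕ} (T : Fin n → ℝ) {e δ : ℝ} {b k : ℕ}
    (hb : (Finset.univ.filter fun j => δ < |T j - e|).card ≤ b) (hbk : b ≤ k)
    (hkn : k + b < n) : |orderStat T k - e| ≤ δ := by
  have hk : k < n := by omega
  rw [orderStat, dif_pos hk]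
  by_contra! hlt
  have hmono := Tuple.monotone_sort T
  have hsub (s : Finset (Fin n)) (hs : ∀ l ∈ s, δ < |T (Tuple.sort T l) - e|) : s.card ≤ b := by
    refine le_trans ?_ hb
    refine Finset.card_le_card_of_injOn (Tuple.sort T) (fun l hl => ?_)
      (Tuple.sort T).injective.injOn
    simpa using hs l hl
  -- A value too large makes the `n - k` order statistics from `k` on bad, one too small the `k + 1`
  -- up to `k`; both counts exceed `b`.
  rcases lt_abs.1 hlt with h | h
  · have := hsub (Finset.Ici ⟨k, hk⟩) fun l hl => by
      have : T (Tuple.sort T ⟨k, hk⟩) ≤ T (Tuple.sort T l) := hmono (Finset.mem_Ici.1 hl)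
      exact lt_of_lt_of_le (by linarith) (le_abs_self _)
    rw [Fin.card_Ici] at this
    simp only at this
    omega
  · have := hsub (Finset.Iic ⟨k, hk⟩) fun l hl => by
      have : T (Tuple.sort T l) ≤ T (Tuple.sort T ⟨k, hk⟩) := hmono (Finset.mem_Iic.1 hl)
      exact lt_of_lt_of_le (by linarith) (neg_le_abs _)
    rw [Fin.card_Iic] at this
    simp only at this
    omega

theorem abs_quantile_sub_le {n : ℕ} (T : Fin n → ℝ) {e δ β : ℝ} {b : ℕ}
    (hb : (Finset.univ.filter fun j => δ < |T j - e|).card ≤ b)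
    (hbn : (b : ℝ) ≤ n / 10) (hn : 10 ≤ n) (hβ₁ : 0.35 ≤ β) (hβ₂ : β ≤ 0.65) :
    |quantile T β - e| ≤ δ := by
  have hn' : (10 : ℝ) ≤ n := by exact_mod_cast hn
  set h : ℝ := β * ((n : ℝ) - 1) with hh
  have h0 : 0.35 * ((n : ℝ) - 1) ≤ h := mul_le_mul_of_nonneg_right hβ₁ (by linarith)
  have h1 : h ≤ 0.65 * ((n : ℝ) - 1) := mul_le_mul_of_nonneg_right hβ₂ (by linarith)
  have hfl : (⌊h⌋₊ : ℝ) ≤ h := Nat.floor_le (by linarith)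
  have hfl' : h < ⌊h⌋₊ + 1 := Nat.lt_floor_add_one h
  have hbk : b ≤ ⌊h⌋₊ := Nat.le_floor (by linarith)
  -- Both interpolation nodes must keep distance `b` from the ends; an index out of range would give
  -- the default 0.
  have hkn : ⌊h⌋₊ + 1 + b < n := by
    have : (⌊h⌋₊ : ℝ) + 1 + b < n := by linarith
    exact_mod_cast this
  have e0 := abs_le.1 (abs_orderStat_sub_le T hb hbk (by omega))
  have e1 := abs_le.1 (abs_orderStat_sub_le T hb (hbk.trans (Nat.le_succ _)) hkn)
  have hq : quantile T β = orderStat T ⌊h⌋₊ +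
      (h - ⌊h⌋₊) * (orderStat T (⌊h⌋₊ + 1) - orderStat T ⌊h⌋₊) := rfl
  rw [hq, abs_le]
  have hθ0 : 0 ≤ h - ⌊h⌋₊ := by linarith
  have hθ1 : h - ⌊h⌋₊ ≤ 1 := by linarith
  change _ ≤ orderStat T (⌊h⌋₊ + 1) - e ∧ orderStat T (⌊h⌋₊ + 1) - e ≤ _ at e1
  generalize h - ⌊h⌋₊ = θ at *
  generalize orderStat T ⌊h⌋₊ = p at *
  generalize orderStat T (⌊h⌋₊ + 1) = q at *
  constructor <;> nlinarith

/-- Nothing is assumed about `t`: the full-sample estimate may be arbitrarily corrupted. -/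
theorem abs_min_max_sub_le {t p q e δ : ℝ} (hp : |p - e| ≤ δ) (hq : |q - e| ≤ δ) :
    |min (max t p) q - e| ≤ δ := by
  rw [abs_le] at *
  have h1 : p ≤ max t p := le_max_right _ _
  have h2 : min (max t p) q ≤ q := min_le_right _ _
  have h3 : e - δ ≤ min (max t p) q := le_min (by linarith) (by linarith)
  constructor <;> linarith

theorem mem_block {N m j : ℕ} {i : Fin N} :
    i ∈ block N m j ↔ j * m ≤ (i : ℕ) ∧ (i : ℕ) < (j + 1) * m := by
  simp [block]

theorem sum_block {N m j : ℕ} (hj : (j + 1) * m ≤ N) (g : ℕ → ℝ) :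
    ∑ i ∈ block N m j, g i = ∑ i : Fin m, g (j * m + i) := by
  have hexp : (j + 1) * m = j * m + m := by ring
  symm
  refine Finset.sum_bij (fun i _ => ⟨j * m + i, by have := i.2; omega⟩) ?_ ?_ ?_ ?_
  · intro i _
    have := i.2
    simp only [mem_block]
    omega
  · intro i _ i' _ h
    ext
    simpa using h
  · intro i hi
    rw [mem_block] at hi
    refine ⟨⟨i - j * m, by omega⟩, Finset.mem_univ _, ?_⟩
    ext
    simp only
    omega
  · intro i _
    rfl

theorem card_block {N m j : ℕ} (hj : (j + 1) * m ≤ N) : (block N m j).card = m := by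
  have := sum_block hj fun _ => 1
  simpa using this

/-- The number of blocks that contain a modified data point. -/
theorem card_modified_blocks_le {N m : ℕ} (s : Finset (Fin N)) :
    (Finset.univ.filter fun j : Fin (N / m) => ∃ i ∈ block N m j, i ∈ s).card ≤ s.card := by
  rw [← Finset.card_image_of_injective _ Fin.val_injective]
  refine le_trans (Finset.card_le_card ?_) (Finset.card_image_le (s := s)
    (f := fun i => (i : ℕ) / m))
  intro j hj
  obtain ⟨j, hj', rfl⟩ := Finset.mem_image.1 hj
  obtain ⟨i, hi, his⟩ := (Finset.mem_filter.1 hj').2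
  refine Finset.mem_image.2 ⟨i, his, ?_⟩
  rw [mem_block] at hi
  -- A data point `i` lies only in block `i / m`.
  exact Nat.div_eq_of_lt_le hi.1 hi.2

theorem eleven_div_sq (K N : ℕ) :
    11 / (12 * √((K : ℝ) / N)) ^ 2 = 11 / 144 * ((N : ℝ) / K) := by
  rw [mul_pow, Real.sq_sqrt (by positivity)]
  rcases K.eq_zero_or_pos with rfl | hK
  · simp
  rcases N.eq_zero_or_pos with rfl | hN
  · simp
  have : (0 : ℝ) < K := by exact_mod_cast hK
  have : (0 : ℝ) < N := by exact_mod_cast hN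
  field_simp
  norm_num

theorem tendsto_blockSize {K : ℕ → ℕ} (hKpos : ∀ᶠ N in atTop, 1 ≤ K N)
    (hK : Tendsto (fun N : ℕ => (K N : ℝ) / (N : ℝ)) atTop (𝓝 0)) :
    Tendsto (fun N => blockSize (12 * √((K N : ℝ) / (N : ℝ)))) atTop atTop := by
  simp only [blockSize, eleven_div_sq]
  refine tendsto_nat_ceil_atTop.comp (Tendsto.const_mul_atTop (by norm_num) ?_)
  have : Tendsto (fun N : ℕ => (K N : ℝ) / (N : ℝ)) atTop (𝓝[>] 0) := by
    refine tendsto_nhdsWithin_iff.2 ⟨hK, ?_⟩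
    filter_upwards [hKpos, eventually_gt_atTop 0] with N h1 h2
    have hK0 : (0 : ℝ) < K N := by exact_mod_cast h1
    have hN0 : (0 : ℝ) < N := by exact_mod_cast h2
    exact div_pos hK0 hN0
  simpa [Function.comp_def] using! tendsto_inv_nhdsGT_zero.comp this

theorem eventually_le_number_of_blocks {K : ℕ → ℕ} (hKpos : ∀ᶠ N in atTop, 1 ≤ K N)
    (hK : Tendsto (fun N : ℕ => (K N : ℝ) / (N : ℝ)) atTop (𝓝 0)) :
    ∀ᶠ N : ℕ in atTop, 13 * K N ≤ N / blockSize (12 * √((K N : ℝ) / (N : ℝ))) := by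
  filter_upwards [hKpos, eventually_gt_atTop 0,
    -- `1872 = 13 * 144`: since `13 * 11 = 143`, the rounding error `13 * K` in the block size has
    -- to fit into `N / 144`.
    hK.eventually (gt_mem_nhds (show (0 : ℝ) < 1 / 1872 by norm_num)),
    (tendsto_blockSize hKpos hK).eventually_gt_atTop 0] with N h1 h2 h3 h4
  rw [Nat.le_div_iff_mul_le h4]
  have hK0 : (0 : ℝ) < K N := by exact_mod_cast h1
  have hN0 : (0 : ℝ) < N := by exact_mod_cast h2
  have hm : (blockSize (12 * √((K N : ℝ) / (N : ℝ))) : ℝ) < 11 / 144 * ((N : ℝ) / K N) + 1 := by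
    rw [blockSize, eleven_div_sq]
    exact Nat.ceil_lt_add_one (by positivity)
  have h5 : (13 * K N : ℝ) * blockSize (12 * √((K N : ℝ) / (N : ℝ))) ≤ N := by
    have h6 : (13 * K N : ℝ) * (11 / 144 * ((N : ℝ) / K N) + 1) = 143 / 144 * N + 13 * K N := by
      field_simp
      ring
    have h7 := mul_le_mul_of_nonneg_left hm.le (show (0 : ℝ) ≤ 13 * K N by positivity)
    rw [div_lt_iff₀ hN0] at h3
    linarith
  exact_mod_cast h5

/-! ### Typical blocks and convergence in probability -/

section Probability

variable {Ω : Type*} [MeasurableSpace Ω]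

/-- The samples of size `m` for which the empirical average of one of the functions `f k` is not
within `η` of its expectation. -/
def atypicalSamples {κ : Type*} (μ : Measure ℝ) (f : κ → ℝ → ℝ) (η : ℝ) (m : ℕ) :
    Set (Fin m → ℝ) :=
  {y | ∃ k, η ≤ |(∑ i, f k (y i)) / m - ∫ x, f k x ∂μ|}

theorem measurableSet_atypicalSamples {κ : Type*} [Countable κ] (μ : Measure ℝ) {f : κ → ℝ → ℝ}
    (hf : ∀ k, Measurable (f k)) (η : ℝ) (m : ℕ) : MeasurableSet (atypicalSamples μ f η m) := by
  rw [atypicalSamples, Set.ofPred_exists]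
  refine MeasurableSet.iUnion fun k => measurableSet_le measurable_const ?_
  have : Measurable fun y : Fin m → ℝ => (∑ i, f k (y i)) / m - ∫ x, f k x ∂μ :=
    ((Finset.measurable_sum _ fun i _ => (hf k).comp (measurable_pi_apply i)).div_const _).sub_const
      _
  exact this.abs

variable {P : Measure Ω} {D : ℕ → Ω → ℝ} {μ : Measure ℝ}

theorem map_block_eq_pi (hD : ∀ i, AEMeasurable (D i) P) (hindep : iIndepFun D P)
    (hlaw : ∀ i, P.map (D i) = μ) (a m : ℕ) :
    P.map (fun ω (i : Fin m) => D (a + i) ω) = Measure.pi fun _ => μ := by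
  have h := (hindep.precomp (g := fun i : Fin m => a + (i : ℕ))
    (fun i i' h => by ext; simpa using h)).map_fun_eq_pi_map fun i => hD _
  simpa only [hlaw] using h

theorem tendsto_measure_abs_average_sub [IsProbabilityMeasure P] 
    (hD : ∀ i, AEMeasurable (D i) P) (hindep : iIndepFun D P)
    (hlaw : ∀ i, P.map (D i) = μ) {f : ℝ → ℝ} (hf : Measurable f)
    (hfi : Integrable f μ) {η : ℝ} (hη : 0 < η) :
    Tendsto (fun m : ℕ => P {ω | η ≤ |(∑ i ∈ Finset.range m, f (D i ω)) / m - ∫ x, f x ∂μ|})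
      atTop (𝓝 0) := by
  have hmean : ∫ ω, f (D 0 ω) ∂P = ∫ x, f x ∂μ := by
    rw [← hlaw 0, integral_map (hD 0) hf.aestronglyMeasurable]
  have hslln := strong_law_ae_real (μ := P) (fun i ω => f (D i ω))
    (by
      have := hfi
      rw [← hlaw 0] at this
      exact this.comp_aemeasurable (hD 0))
    (fun i j hij => (hindep.indepFun hij).comp hf hf)
    (fun i => (IdentDistrib.mk (hD i) (hD 0) (by rw [hlaw, hlaw])).comp hf)
  have h := tendstoInMeasure_of_tendsto_ae (fun m => by
    have : AEMeasurable (fun ω => (∑ i ∈ Finset.range m, f (D i ω)) / m) P :=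
      (Finset.aemeasurable_fun_sum _ fun i _ => hf.comp_aemeasurable (hD i)).div_const _
    exact this.aestronglyMeasurable) hslln
  rw [tendstoInMeasure_iff_norm] at h
  simpa only [hmean, Real.norm_eq_abs] using h η hη

/-- Under the product law this probability is the same for every block of length `m`, so the strong
law along the initial segments, with a union bound over `k`, covers all blocks. -/
theorem tendsto_pi_atypicalSamples {κ : Type*} [Fintype κ] [IsProbabilityMeasure P]
    (hD : ∀ i, AEMeasurable (D i) P) (hindep : iIndepFun D P) (hlaw : ∀ i, P.map (D i) = μ)
    {f : κ → ℝ → ℝ} (hf : ∀ k, Measurable (f k)) (hfi : ∀ k, Integrable (f k) μ) {η : ℝ} (hη : 0 < η) :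
    Tendsto (fun m : ℕ => Measure.pi (fun _ : Fin m => μ) (atypicalSamples μ f η m))
      atTop (𝓝 0) := by
  have hsum : Tendsto (fun m : ℕ => ∑ k,
      P {ω | η ≤ |(∑ i ∈ Finset.range m, f k (D i ω)) / m - ∫ x, f k x ∂μ|}) atTop (𝓝 0) := by
    have := tendsto_finsetSum Finset.univ fun k _ =>
      tendsto_measure_abs_average_sub hD hindep hlaw (hf k) (hfi k) hη
    simpa using this
  refine tendsto_of_tendsto_of_tendsto_of_le_of_le tendsto_const_nhds hsum
    (fun _ => zero_le) fun m => ?_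
  simp only
  rw [← map_block_eq_pi hD hindep hlaw 0 m, Measure.map_apply_of_aemeasurable
    (aemeasurable_pi_lambda _ fun i => hD _) (measurableSet_atypicalSamples μ hf η m)]
  refine le_trans (measure_mono fun ω hω => ?_) (measure_iUnion_fintype_le P _)
  obtain ⟨k, hk⟩ := hω
  refine Set.mem_iUnion.2 ⟨k, ?_⟩
  rw [Set.mem_ofPred_eq, Finset.sum_range]
  simpa using hk

open Classical in
/-- Markov's inequality for the number of events that occur. -/
theorem measure_card_events_le {n : ℕ} (hn : 0 < n) (A : Fin n → Set Ω)
    (hA : ∀ j, NullMeasurableSet (A j) P) {p : ℝ≥0∞} (hp : ∀ j, P (A j) ≤ p) (c : ℕ) :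
    P {ω | n ≤ c * (Finset.univ.filter fun j => ω ∈ A j).card} ≤ c * p := by
  have hcount (ω : Ω) : ((Finset.univ.filter fun j => ω ∈ A j).card : ℝ≥0∞) =
      ∑ j, (A j).indicator 1 ω := by
    simp [Set.indicator_apply]
  have hmeas (j : Fin n) : AEMeasurable ((A j).indicator (1 : Ω → ℝ≥0∞)) P :=
    aemeasurable_one.indicator₀ (hA j)
  have hM := mul_meas_ge_le_lintegral₀ (μ := P)
    (f := fun ω => (c : ℝ≥0∞) * ∑ j, (A j).indicator 1 ω)
    ((Finset.aemeasurable_fun_sum _ fun j _ => hmeas j).const_mul _) n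
  have hset : {ω | n ≤ c * (Finset.univ.filter fun j => ω ∈ A j).card} =
      {ω | (n : ℝ≥0∞) ≤ c * ∑ j, (A j).indicator 1 ω} := by
    ext ω
    rw [Set.mem_ofPred_eq, Set.mem_ofPred_eq, ← hcount]
    norm_cast
  have hint : ∫⁻ ω, (c : ℝ≥0∞) * ∑ j, (A j).indicator 1 ω ∂P ≤ n * (c * p) := by
    rw [lintegral_const_mul' _ _ (by simp), lintegral_finsetSum' _ fun j _ => hmeas j]
    calc (c : ℝ≥0∞) * ∑ j, ∫⁻ ω, (A j).indicator 1 ω ∂P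
        = c * ∑ j, P (A j) := by simp only [lintegral_indicator_one₀ (hA _)]
      _ ≤ c * ∑ _j : Fin n, p := by gcongr; exact hp _
      _ = n * (c * p) := by simp; ring
  rw [hset]
  exact (ENNReal.mul_le_mul_iff_right (by simpa using hn.ne') (by simp)).1 (hM.trans hint)

/-- The estimator is consistent in the presence of a vanishing fraction of modified data as soon as
the upper tail is integrable. -/
theorem tendstoInMeasure_estimator [IsProbabilityMeasure P] [IsProbabilityMeasure μ]
    (hD : ∀ i, AEMeasurable (D i) P) (hindep : iIndepFun D P) (hlaw : ∀ i, P.map (D i) = μ)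
    {α : ℝ} (hα0 : 0 < α) (hα1 : α < 1)
    (hint : Integrable (fun x => max (x - VaR (cdf μ) (1 - α)) 0) μ)
    {β₁ β₂ : ℝ} (hβ₁ : 0.35 ≤ β₁) (hβ : β₁ ≤ β₂) (hβ₂ : β₂ ≤ 0.65)
    {K : ℕ → ℕ} (hKpos : ∀ᶠ N in atTop, 1 ≤ K N)
    (hK : Tendsto (fun N : ℕ => (K N : ℝ) / (N : ℝ)) atTop (𝓝 0))
    {Dmod : (N : ℕ) → Ω → Fin N → ℝ}
    (hmod : ∀ N : ℕ, ∀ᵐ ω ∂P,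
      (Finset.univ.filter fun i : Fin N => Dmod N ω i ≠ D i ω).card ≤ K N) :
    TendstoInMeasure P
      (fun (N : ℕ) (ω : Ω) => estimator α β₁ β₂ (12 * √((K N : ℝ) / (N : ℝ))) (Dmod N ω))
      atTop (fun _ => ES α (cdf μ)) := by
  classical
  rw [tendstoInMeasure_iff_norm]
  intro δ hδ
  obtain ⟨f, hfm, hfi, η, hη, hf⟩ := exists_test_functions μ hα0 hα1 hint (half_pos hδ)
  have hlim : Tendsto (fun N => ((50 : ℕ) : ℝ≥0∞) *
      Measure.pi (fun _ => μ)
        (atypicalSamples μ f η (blockSize (12 * √((K N : ℝ) / (N : ℝ)))))) atTop (𝓝 0) := by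
    have := ENNReal.Tendsto.const_mul (a := ((50 : ℕ) : ℝ≥0∞))
      ((tendsto_pi_atypicalSamples hD hindep hlaw hfm hfi hη).comp (tendsto_blockSize hKpos hK))
      (Or.inr (by simp))
    rwa [mul_zero] at this
  refine tendsto_of_tendsto_of_tendsto_of_le_of_le' tendsto_const_nhds hlim
    (Eventually.of_forall fun _ => zero_le) ?_
  filter_upwards [hKpos, eventually_le_number_of_blocks hKpos hK,
    (tendsto_blockSize hKpos hK).eventually_gt_atTop 0] with N hK1 hn hm
  set ε := 12 * √((K N : ℝ) / (N : ℝ)) with hε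
  set m := blockSize ε with hm_def
  have hA (j : Fin (N / m)) : AEMeasurable (fun ω (i : Fin m) => D (j * m + i) ω) P :=
    aemeasurable_pi_lambda _ fun i => hD _
  have hBm := measurableSet_atypicalSamples μ hfm η m
  refine le_trans ?_ (measure_card_events_le (P := P) (by omega)
    (fun j : Fin (N / m) => (fun ω (i : Fin m) => D (j * m + i) ω) ⁻¹' atypicalSamples μ f η m)
    (fun j => (hA j).nullMeasurable hBm)
    (p := Measure.pi (fun _ => μ) (atypicalSamples μ f η m))
    (fun j => by
      rw [← map_block_eq_pi hD hindep hlaw (j * m) m,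
        Measure.map_apply_of_aemeasurable (hA j) hBm]) 50)
  refine measure_mono_ae ?_
  filter_upwards [hmod N] with ω hω hdist
  change N / m ≤ _
  by_contra! hcard
  have hdist : δ ≤ ‖estimator α β₁ β₂ ε (Dmod N ω) - ES α (cdf μ)‖ := hdist
  refine absurd hdist (not_le.2 (lt_of_le_of_lt ?_ (half_lt_self hδ)))
  set cnt := (Finset.univ.filter fun j : Fin (N / m) =>
    ω ∈ (fun ω (i : Fin m) => D (j * m + i) ω) ⁻¹' atypicalSamples μ f η m).card with hcnt
  have hbad : (Finset.univ.filter fun j : Fin (N / m) =>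
      δ / 2 < |blockEstimates α ε (Dmod N ω) j - ES α (cdf μ)|).card ≤ K N + cnt := by
    -- A bad block contains a modified point or its original sample is atypical.
    refine le_trans (Finset.card_le_card ?_) ((Finset.card_union_le _ _).trans
      (Nat.add_le_add_right ((card_modified_blocks_le _).trans hω) cnt))
    intro j hj
    rw [Finset.mem_union, Finset.mem_filter, Finset.mem_filter]
    by_contra! hgood
    obtain ⟨hclean, htyp⟩ := hgood
    replace hclean : ∀ i ∈ block N m j, Dmod N ω i = D i ω := by
      intro i hi
      by_contra hne
      exact hclean (Finset.mem_univ _) i hi (by simpa using hne)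
    replace htyp := htyp (Finset.mem_univ _)
    have hjN : ((j : ℕ) + 1) * m ≤ N :=
      (Nat.mul_le_mul_right m j.2).trans (Nat.div_mul_le_self N m)
    have hne : (block N m j).Nonempty := by
      rw [← Finset.card_pos, card_block hjN]
      exact hm
    refine absurd (Finset.mem_filter.1 hj).2 (not_lt.2 (hf _ _ _ hne fun k => ?_).le)
    rw [card_block hjN, Finset.sum_congr rfl fun i hi => by rw [hclean i hi],
      sum_block hjN fun i => f k (D i ω)]
    by_contra! hk
    exact htyp ⟨k, hk⟩
  have hn10 : 10 ≤ N / m := le_trans (by omega) hn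
  have hb : ((K N + cnt : ℕ) : ℝ) ≤ ((N / m : ℕ) : ℝ) / 10 := by
    have h1 : (13 * K N : ℝ) ≤ ((N / m : ℕ) : ℝ) := by exact_mod_cast hn
    have h2 : (50 * cnt : ℝ) ≤ ((N / m : ℕ) : ℝ) := by exact_mod_cast hcard.le
    push_cast at *
    linarith
  exact abs_min_max_sub_le
    (abs_quantile_sub_le _ hbad hb hn10 hβ₁ (hβ.trans hβ₂))
    (abs_quantile_sub_le _ hbad hb hn10 (hβ₁.trans hβ) hβ₂)

end Probability

end ExpectedShortfall

theorem mainTheorem8 {Ω : Type*} [MeasurableSpace Ω] (P : Measure Ω) [IsProbabilityMeasure P]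
    -- the level and the hyperparameters of the estimator
    (α : ℝ) (hα0 : 0 < α) (hα : α < 1 / 2)
    (β₁ β₂ : ℝ) (hβ₁ : 0.35 ≤ β₁) (hβ : β₁ ≤ β₂) (hβ₂ : β₂ ≤ 0.65)
    -- the loss `X` and the i.i.d. data `D 0, D 1, ...` with the law of `X`
    (X : Ω → ℝ) (D : ℕ → Ω → ℝ)
    (hIndep : iIndepFun D P) (hIdent : ∀ i, IdentDistrib (D i) X P P)
    (hσ : ExpectedShortfall.sigmaSq α (cdf (P.map X)) ≠ ∞)
    (hLip : ∃ L : ℝ≥0, ∃ U ∈ 𝓝 (1 - α),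
      LipschitzOnWith L (ExpectedShortfall.VaR (cdf (P.map X))) U)
    -- at most `K N` points of the sample of size `N` are modified, in an arbitrary way that may
    -- depend on everything; `K N < N` for large `N` follows from the limit
    (K : ℕ → ℕ) (hKpos : ∀ᶠ N in atTop, 1 ≤ K N)
    (hK : Tendsto (fun N : ℕ => (K N : ℝ) / (N : ℝ)) atTop (𝓝 0))
    (Dmod : (N : ℕ) → Ω → Fin N → ℝ)
    (hmod : ∀ N : ℕ, ∀ᵐ ω ∂P,
      (Finset.univ.filter fun i : Fin N => Dmod N ω i ≠ D i ω).card ≤ K N) :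
    -- the integral that defines the expected shortfall converges
    IntervalIntegrable (ExpectedShortfall.VaR (cdf (P.map X))) volume (1 - α) 1 ∧
    TendstoInMeasure P
      (fun (N : ℕ) (ω : Ω) => ExpectedShortfall.estimator α β₁ β₂
        (12 * √((K N : ℝ) / (N : ℝ))) (Dmod N ω))
      atTop (fun _ => ExpectedShortfall.ES α (cdf (P.map X))) := by
  have hX : AEMeasurable X P := (hIdent 0).aemeasurable_snd
  have hprob : IsProbabilityMeasure (P.map X) := Measure.isProbabilityMeasure_map hX
  have hα1 : α < 1 := by linarith
  have hint := ExpectedShortfall.integrable_of_sigmaSq_ne_top (P.map X) hα0 hα1 hσ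
  exact ⟨ExpectedShortfall.intervalIntegrable_VaR (P.map X) hα0 hα1 hint,
    ExpectedShortfall.tendstoInMeasure_estimator (fun i => (hIdent i).aemeasurable_fst) hIndep
      (fun i => (hIdent i).map_eq) hα0 hα1 hint hβ₁ hβ hβ₂ hKpos hK hmod⟩
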